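/- **Setting.** For $n\ge 4$, a random Euclidean instance of size $n$ consists of $n$ independent uniform random points $P_1,\dots,P_n$ in the unit square $[0,1]^2$ and, independently, a uniform random permutation $\pi$ of $\{1,\dots,n\}$, the tour. The cost is $c(u,v)=\|P_u-P_v\|$, and positions are read cyclically ($\pi_{n+1}=\pi_1$). The $i$-th tour edge is $\{\pi_i,\pi_{i+1}\}$. For two distinct, non-consecutive tour edges $i,j$, the 2-OPT move $\mu(i,j)$ replaces $\{\pi_i,\pi_{i+1}\},\{\pi_j,\pi_{j+1}\}$ by $\{\pi_i,\pi_j\},\{\pi_{i+1},\pi_{j+1}\}$ and has value $$\Delta(\mu(i,j))=c(\pi_i,\pi_{i+1})+c(\pi_j,\pi_{j+1})-c(\pi_i,\pi_j)-c(\pi_{i+1},\pi_{j+1}).$$ To *expand* the $i$-th tour edge is to evaluate all the $n-3$ moves $\mu(i,j)$, one after the other, replacing the current champion $\hat\mu$ by each move of larger value. The time of an algorithm is the number of moves that it evaluates (a move evaluated twice counts twice). Two algorithms are considered. * The greedy algorithm $\mathcal A_g$ starts with an undefined champion, $\Delta(\hat\mu)=-\infty$, and with all tour edges in a max-heap ordered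 by cost (ties in any order). While the heap is non-empty and the cost of its top edge is greater than $\Delta(\hat\mu)/2$, it extracts the top edge and expands it. * For a sequence of real thresholds $\delta_n$, the heuristic $\mathrm{ALG}(\delta_n)$ expands, on instances of size $n$, all and only the tour edges of cost greater than $\delta_n$. Let $T^n_{\mathcal A_g}$ and $T^n_{\mathrm{ALG}(\delta_n)}$ be the times of the two algorithms on a random Euclidean instance of size $n$. **Theorem.** For every $p\in[0,1)$ there is a constant $c>0$ such that, with $\delta_n=\sqrt2-c\,n^{-1/4}$, the average time satisfies $$\mathbb E\big[T^n_{\mathrm{ALG}(\delta_n)}\big]=\Theta(n)\qquad(n\to\infty),$$ and there is an integer $n_0$ such that for all $n\ge n_0$ $$\Pr\big[T^n_{\mathcal A_g}\le T^n_{\mathrm{ALG}(\delta_n)}\big]>p,$$ where the event is that the inequality holds however the heap breaks ties. -/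

import Mathlib

open MeasureTheory Filter Asymptotics

noncomputable section

namespace TwoOpt

/-- An instance of size `n`: symmetric non-negative edge costs on the complete graph on `Fin n`,
and a tour, which visits `tour 0, tour 1, …, tour (n - 1)` cyclically. -/
structure Instance (n : ℕ) where
  cost : Fin n → Fin n → ℝ
  cost_symm : ∀ u v, cost u v = cost v u
  cost_nonneg : ∀ u v, 0 ≤ cost u v
  tour : Equiv.Perm (Fin n)

/-- The cyclic successor of a tour position. -/
def next {n : ℕ} (i : Fin n) : Fin n := finRotate n i

/-- Cost of the `i`-th tour edge, which joins the nodes at positions `i` and `i + 1`. -/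
def Instance.edgeCost {n : ℕ} (I : Instance n) (i : Fin n) : ℝ :=
  I.cost (I.tour i) (I.tour (next i))

/-- The value `Δ(μ(i,j))` of the 2-OPT move that removes the `i`-th and the `j`-th tour edge. -/
def Instance.gain {n : ℕ} (I : Instance n) (i j : Fin n) : ℝ :=
  I.edgeCost i + I.edgeCost j
    - (I.cost (I.tour i) (I.tour j) + I.cost (I.tour (next i)) (I.tour (next j)))

/-- State of a search procedure: the champion move found so far (`none` if still undefined), and
the number of elementary steps, that is, of moves evaluated so far. -/
structure State (n : ℕ) where
  champion : Option (Fin n × Fin n)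
  steps : ℕ

/-- No champion yet, no move evaluated yet. -/
def State.init (n : ℕ) : State n := ⟨none, 0⟩

/-- The value `Δ` of the champion, which is `-∞` while the champion is undefined. -/
def Instance.championValue {n : ℕ} (I : Instance n) : Option (Fin n × Fin n) → WithBot ℝ
  | none => ⊥
  | some m => (I.gain m.1 m.2 : WithBot ℝ)

/-- The `i`-th tour edge is large: its cost exceeds half of the value of the champion (always so
while the champion is undefined). -/
def Instance.IsLarge {n : ℕ} (I : Instance n) (champion : Option (Fin n × Fin n)) (i : Fin n) :
    Prop :=
  match champion with
  | none => True
  | some m => I.gain m.1 m.2 / 2 < I.edgeCost i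

open Classical in
/-- One elementary step: evaluate the move `μ(i,j)` and update the champion if the move is
better. -/
def Instance.evaluate {n : ℕ} (I : Instance n) (i : Fin n) (s : State n) (j : Fin n) : State n where
  champion :=
    if I.championValue s.champion < (I.gain i j : WithBot ℝ) then some (i, j) else s.champion
  steps := s.steps + 1

/-- The positions `j`, in increasing order, such that the `i`-th and the `j`-th tour edge are
distinct and not consecutive along the (cyclic) tour. -/
def partners {n : ℕ} (i : Fin n) : List (Fin n) :=
  (List.finRange n).filter (fun j => decide (j ≠ i ∧ j ≠ next i ∧ i ≠ next j))

/-- Expansion of the `i`-th tour edge: evaluate, one by one, all moves that remove it. -/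
def Instance.expand {n : ℕ} (I : Instance n) (i : Fin n) (s : State n) : State n :=
  (partners i).foldl (I.evaluate i) s

/-- `i` may be on top of a max-heap with the set `H` of tour edges, ordered by cost. -/
def Instance.IsTop {n : ℕ} (I : Instance n) (H : Finset (Fin n)) (i : Fin n) : Prop :=
  i ∈ H ∧ ∀ k ∈ H, I.edgeCost k ≤ I.edgeCost i

/-- `I.GreedyLoop H s s'`: the main loop of the greedy algorithm, entered with the heap `H` and in
the state `s`, can end in the state `s'`. Nothing is assumed on how the heap orders ties. -/
inductive Instance.GreedyLoop {n : ℕ} (I : Instance n) :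
    Finset (Fin n) → State n → State n → Prop
  | empty (s : State n) : Instance.GreedyLoop I ∅ s s
  | finish (H : Finset (Fin n)) (i : Fin n) (s : State n) (htop : I.IsTop H i)
      (hsmall : ¬ I.IsLarge s.champion i) : Instance.GreedyLoop I H s s
  | step (H : Finset (Fin n)) (i : Fin n) (s s' : State n) (htop : I.IsTop H i)
      (hlarge : I.IsLarge s.champion i)
      (hrest : Instance.GreedyLoop I (H.erase i) (I.expand i s) s') :
      Instance.GreedyLoop I H s s'

/-- The greedy algorithm started with all tour edges in the heap can evaluate exactly `t` moves.
(The number `t` is unique unless two tour edges have the same cost.) -/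
def Instance.GreedyTime {n : ℕ} (I : Instance n) (t : ℕ) : Prop :=
  ∃ s : State n, I.GreedyLoop Finset.univ (State.init n) s ∧ s.steps = t

/-- The greedy loop always terminates. -/
theorem Instance.exists_greedyLoop {n : ℕ} (I : Instance n) (H : Finset (Fin n)) :
    ∀ s : State n, ∃ s' : State n, I.GreedyLoop H s s' := by
  induction H using Finset.strongInduction with
  | H H ih =>
    intro s
    rcases H.eq_empty_or_nonempty with rfl | hne
    · exact ⟨s, .empty s⟩
    · obtain ⟨i, hi, hmax⟩ := H.exists_max_image I.edgeCost hne
      by_cases hl : I.IsLarge s.champion i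
      · obtain ⟨s', hs'⟩ := ih _ (Finset.erase_ssubset hi) (I.expand i s)
        exact ⟨s', .step H i s s' ⟨hi, hmax⟩ hl hs'⟩
      · exact ⟨s, .finish H i s ⟨hi, hmax⟩ hl⟩

theorem Instance.exists_greedyTime {n : ℕ} (I : Instance n) : ∃ t : ℕ, I.GreedyTime t := by
  obtain ⟨s, hs⟩ := I.exists_greedyLoop Finset.univ (State.init n)
  exact ⟨s.steps, s, hs, rfl⟩

open Classical in
/-- The fixed-threshold heuristic `ALG(δ)`: a simple loop over the tour edges, which expands
all and only those of cost greater than `δ`. -/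
def Instance.alg {n : ℕ} (I : Instance n) (δ : ℝ) : State n :=
  (List.finRange n).foldl (fun s i => if δ < I.edgeCost i then I.expand i s else s) (State.init n)

/-- The number of moves that `ALG(δ)` evaluates. -/
def Instance.algTime {n : ℕ} (I : Instance n) (δ : ℝ) : ℕ := (I.alg δ).steps

/-- The Euclidean plane. -/
abbrev Plane : Type := EuclideanSpace ℝ (Fin 2)

/-- The unit square `[0,1] × [0,1]`. -/
def unitSquare : Set Plane := {x | ∀ k, x k ∈ Set.Icc (0 : ℝ) 1}

/-- All sets of permutations are events. -/
instance permMeasurableSpace (n : ℕ) : MeasurableSpace (Equiv.Perm (Fin n)) := ⊤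

/-- The law of a random Euclidean instance: `n` independent uniform points of the unit square
and, independently of them, a uniform permutation as the tour. -/
def euclideanLaw (n : ℕ) : Measure ((Fin n → Plane) × Equiv.Perm (Fin n)) :=
  (Measure.pi fun _ : Fin n => ProbabilityTheory.cond (volume : Measure Plane) unitSquare).prod
    (ProbabilityTheory.uniformOn Set.univ)

/-- The instance given by points and a tour: costs are Euclidean distances. -/
def euclideanInstance {n : ℕ} (ω : (Fin n → Plane) × Equiv.Perm (Fin n)) : Instance n where
  cost u v := dist (ω.1 u) (ω.1 v)
  cost_symm _ _ := dist_comm _ _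
  cost_nonneg _ _ := dist_nonneg
  tour := ω.2

/-- The average time of `ALG(δ)` on random Euclidean instances of size `n`. -/
def avgAlgTime (n : ℕ) (δ : ℝ) : ℝ :=
  ∫ ω, ((euclideanInstance ω).algTime δ : ℝ) ∂(euclideanLaw n)

/-- The thresholds `δ_n = √2 - c n^{-1/4}`. -/
def threshold (c : ℝ) (n : ℕ) : ℝ := Real.sqrt 2 - c * (n : ℝ) ^ (-(1 / 4 : ℝ))

end TwoOpt

end

open ProbabilityTheory

namespace TwoOpt

/-! ### Deterministic comparison of the greedy loop with a fixed threshold. -/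

namespace Instance

variable {n : ℕ} (I : Instance n)

/-! The comparison is deterministic once one good move exists: an edge `i` of cost above `δ` and a
move `μ(i,j)` of value at least `2δ`. Until `i` leaves the heap, the top costs at least as much as
`i`; afterwards the champion is worth at least `2δ`, so only edges above `δ` are still large. Hence
greedy expands no edge that `ALG(δ)` skips (`GreedyLoop.steps_le`, `GreedyTime.le_algTime`).

Such a move arises from two tour edges leading, in the same direction, from the lower left corner
box of side `η` to the upper right one: two near-diagonals are exchanged for two short edges
(`greedyTime_le_algTime`). Given the tour, one edge does this with probability `η ^ 4`,
independently for vertex-disjoint edges. With `η` of order `c * n ^ (-1/4)`, each of two blocks of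
about `n / 4` disjoint edges fails with probability at most `exp (-c ^ 4 / 10000)`, which a large
`c` makes small (`le_prob_greedyTime_le_algTime`).

The average time is a sum over edges of roughly `n` times the probability of exceeding the
threshold. That probability is of order `1 / n`: corner-to-corner edges bound it below, and above,
an edge of length close to `√2` must have both ends near corners (`mem_box_of_lt_dist`). -/

theorem foldl_evaluate_steps (i : Fin n) (l : List (Fin n)) (s : State n) :
    (l.foldl (I.evaluate i) s).steps = s.steps + l.length := by
  induction l generalizing s with
  | nil => rfl
  | cons j l ih => simp only [List.foldl_cons, ih, List.length_cons, evaluate]; omega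

theorem expand_steps (i : Fin n) (s : State n) :
    (I.expand i s).steps = s.steps + (partners i).length :=
  I.foldl_evaluate_steps i _ s

theorem championValue_le_evaluate (i j : Fin n) (s : State n) :
    I.championValue s.champion ≤ I.championValue (I.evaluate i s j).champion := by
  by_cases h : I.championValue s.champion < (I.gain i j : WithBot ℝ)
  · simp only [evaluate, if_pos h]; exact h.le
  · simp only [evaluate, if_neg h]; exact le_rfl

theorem gain_le_evaluate (i j : Fin n) (s : State n) :
    (I.gain i j : WithBot ℝ) ≤ I.championValue (I.evaluate i s j).champion := by
  by_cases h : I.championValue s.champion < (I.gain i j : WithBot ℝ)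
  · simp only [evaluate, if_pos h]; exact le_rfl
  · simp only [evaluate, if_neg h]; exact not_lt.1 h

theorem championValue_le_foldl (i : Fin n) (l : List (Fin n)) (s : State n) :
    I.championValue s.champion ≤ I.championValue (l.foldl (I.evaluate i) s).champion := by
  induction l generalizing s with
  | nil => exact le_rfl
  | cons j l ih => exact (I.championValue_le_evaluate i j s).trans (ih _)

theorem gain_le_foldl (i : Fin n) (l : List (Fin n)) (s : State n) {j : Fin n} (hj : j ∈ l) :
    (I.gain i j : WithBot ℝ) ≤ I.championValue (l.foldl (I.evaluate i) s).champion := by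
  induction l generalizing s with
  | nil => simp at hj
  | cons k l ih =>
    rcases List.mem_cons.1 hj with rfl | hj
    · exact (I.gain_le_evaluate i j s).trans (I.championValue_le_foldl i l _)
    · exact ih _ hj

open Classical in
/-- The greedy loop expands only edges above `δ` if some move with an edge above `δ` gains at
least `2 * δ`. -/
theorem GreedyLoop.steps_le {δ : ℝ} {i j : Fin n} (hj : j ∈ partners i)
    (hi : δ < I.edgeCost i) (hg : 2 * δ ≤ I.gain i j) {H : Finset (Fin n)} {s s' : State n}
    (h : I.GreedyLoop H s s')
    (hs : i ∉ H → (I.gain i j : WithBot ℝ) ≤ I.championValue s.champion) :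
    s'.steps ≤ s.steps + ∑ k ∈ H, if δ < I.edgeCost k then (partners k).length else 0 := by
  induction h with
  | empty s => simp
  | finish H k s _ _ => simp
  | step H k s s' htop hlarge hrest ih =>
    -- If the top `k` cost at most `δ`, then `i` would already be expanded, and a champion worth at
    -- least `2 * δ` contradicts `hlarge`.
    have hk : δ < I.edgeCost k := by
      by_contra hk
      have hiH : i ∉ H := fun hiH => hk (hi.trans_le (htop.2 i hiH))
      have h1 := hs hiH
      unfold IsLarge at hlarge
      cases hc : s.champion with
      | none => simp [hc, championValue] at h1
      | some m =>
        simp only [hc, championValue, WithBot.coe_le_coe] at h1 hlarge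
        linarith
    have h2 := ih (fun hiH => by
      by_cases hik : i = k
      · subst hik; exact I.gain_le_foldl i _ s hj
      · exact (hs fun h => hiH (Finset.mem_erase.2 ⟨hik, h⟩)).trans
          (I.championValue_le_foldl k _ s))
    rw [expand_steps] at h2
    rw [← Finset.add_sum_erase H _ htop.1, if_pos hk]
    omega

open Classical in
theorem algTime_eq_sum (δ : ℝ) :
    I.algTime δ = ∑ k, if δ < I.edgeCost k then (partners k).length else 0 := by
  have key : ∀ (l : List (Fin n)) (s : State n),
      (l.foldl (fun s i => if δ < I.edgeCost i then I.expand i s else s) s).steps =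
        s.steps + (l.map fun k => if δ < I.edgeCost k then (partners k).length else 0).sum := by
    intro l
    induction l with
    | nil => simp
    | cons k l ih =>
      intro s
      simp only [List.foldl_cons, ih, List.map_cons, List.sum_cons]
      split_ifs
      · rw [expand_steps]; omega
      · omega
  rw [algTime, alg, key, ← List.ofFn_eq_map, List.sum_ofFn]
  simp [State.init]

theorem GreedyTime.le_algTime {δ : ℝ} {i j : Fin n} (hj : j ∈ partners i)
    (hi : δ < I.edgeCost i) (hg : 2 * δ ≤ I.gain i j) {t : ℕ} (ht : I.GreedyTime t) :
    t ≤ I.algTime δ := by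
  obtain ⟨s, hs, rfl⟩ := ht
  have := GreedyLoop.steps_le I hj hi hg hs (by simp)
  rw [algTime_eq_sum]
  simpa [State.init] using this

end Instance

/-! ### Counting moves per edge, and cyclic successors. -/

theorem length_partners_le {n : ℕ} (i : Fin n) : (partners i).length ≤ n := by
  exact (List.length_filter_le _ _).trans_eq List.length_finRange

theorem le_length_partners {n : ℕ} (i : Fin n) : n ≤ (partners i).length + 3 := by
  classical
  have hcard : (partners i).length = (partners i).toFinset.card :=
    (List.toFinset_card_of_nodup ((List.nodup_finRange n).filter _)).symm
  have hsub : (Finset.univ : Finset (Fin n)) ⊆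
      (partners i).toFinset ∪ {i, next i, (finRotate n).symm i} := by
    intro j _
    by_cases h : j ∈ partners i
    · simp [h]
    · have h' : ¬ (j ≠ i ∧ j ≠ next i ∧ i ≠ next j) := by simpa [partners] using h
      have : i = next j → j = (finRotate n).symm i := by
        rintro rfl; exact ((finRotate n).symm_apply_apply j).symm
      simp only [Finset.mem_union, Finset.mem_insert, Finset.mem_singleton]
      tauto
  have h1 := Finset.card_le_card hsub
  have h2 := Finset.card_union_le (partners i).toFinset {i, next i, (finRotate n).symm i}
  have h3 := Finset.card_le_three (a := i) (b := next i) (c := (finRotate n).symm i)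
  rw [Finset.card_univ, Fintype.card_fin] at h1
  omega

theorem next_mk {n k : ℕ} (h : k + 1 < n) :
    next (⟨k, Nat.lt_of_succ_lt h⟩ : Fin n) = ⟨k + 1, h⟩ := by
  obtain ⟨m, rfl⟩ : ∃ m, n = m + 1 := ⟨n - 1, by omega⟩
  exact finRotate_of_lt (by omega)

theorem next_ne {n : ℕ} (hn : 2 ≤ n) (i : Fin n) : next i ≠ i := by
  obtain ⟨m, rfl⟩ : ∃ m, n = m + 2 := ⟨n - 2, by omega⟩
  rw [next, finRotate_apply]
  simp

/-! ### Geometry of long edges in the unit square. -/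

/-- The set of points of the plane with both coordinates in `S`. -/
def box (S : Set ℝ) : Set Plane := {x | ∀ k, x k ∈ S}

theorem dist_plane (x y : Plane) : dist x y = √((x 0 - y 0) ^ 2 + (x 1 - y 1) ^ 2) := by
  simp [EuclideanSpace.dist_eq, Real.dist_eq, sq_abs]

theorem dist_le_of_mem_box {a b : ℝ} {x y : Plane} (hab : a ≤ b) (hx : x ∈ box (Set.Icc a b))
    (hy : y ∈ box (Set.Icc a b)) : dist x y ≤ √2 * (b - a) := by
  have h : ∀ k, (x k - y k) ^ 2 ≤ (b - a) ^ 2 := fun k => by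
    have h1 := hx k; have h2 := hy k
    simp only [Set.mem_Icc] at h1 h2
    apply sq_le_sq' <;> linarith
  rw [dist_plane, ← Real.sqrt_sq (sub_nonneg.2 hab), ← Real.sqrt_mul (by norm_num)]
  exact Real.sqrt_le_sqrt (by linarith [h 0, h 1])

theorem le_dist_of_mem_box {η : ℝ} (hη : η ≤ 1 / 2) {x y : Plane}
    (hx : x ∈ box (Set.Icc 0 η)) (hy : y ∈ box (Set.Icc (1 - η) 1)) :
    √2 * (1 - 2 * η) ≤ dist x y := by
  have h : ∀ k, (1 - 2 * η) ^ 2 ≤ (x k - y k) ^ 2 := fun k => by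
    have h1 := hx k; have h2 := hy k
    simp only [Set.mem_Icc] at h1 h2
    rw [← neg_sub (y k), neg_sq]
    apply sq_le_sq' <;> linarith
  rw [dist_plane, ← Real.sqrt_sq (show 0 ≤ 1 - 2 * η by linarith), ← Real.sqrt_mul (by norm_num)]
  exact Real.sqrt_le_sqrt (by linarith [h 0, h 1])

/-- The squared coordinate differences are at most 1 and sum to more than `(√2 - ε) ^ 2 ≥ 2 - 3 *
ε`, so each exceeds `1 - 3 * ε`. A number in `[0, 1]` dominates its square, so each absolute
difference does too. -/
theorem mem_box_of_lt_dist {ε : ℝ} (hε : ε ≤ √2) {x y : Plane} (hx : x ∈ unitSquare)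
    (hy : y ∈ unitSquare) (h : √2 - ε < dist x y) :
    x ∈ box (Set.Icc 0 (3 * ε) ∪ Set.Icc (1 - 3 * ε) 1) := by
  have h2 : √2 < 3 / 2 := by rw [Real.sqrt_lt' (by norm_num)]; norm_num
  have hs : √2 ^ 2 = 2 := Real.sq_sqrt (by norm_num)
  rw [dist_plane, Real.lt_sqrt (by linarith)] at h
  have hb : ∀ k, (x k - y k) ^ 2 ≤ 1 := fun k => by
    have h1 := hx k; have h2 := hy k
    simp only [Set.mem_Icc] at h1 h2
    nlinarith
  have hε0 : 0 < ε := by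
    by_contra hε'
    nlinarith [hb 0, hb 1, mul_nonneg (Real.sqrt_nonneg 2) (neg_nonneg.2 (not_lt.1 hε')), sq_nonneg ε]
  have hk : ∀ k, 1 - 3 * ε < (x k - y k) ^ 2 := by
    rw [Fin.forall_fin_two]
    constructor <;> nlinarith [hb 0, hb 1]
  intro k
  have h1 := hx k; have h2 := hy k; have h3 := hk k
  simp only [Set.mem_Icc] at h1 h2
  simp only [Set.mem_union, Set.mem_Icc]
  rcases le_total (x k) (y k) with hxy | hxy
  · left; constructor <;> nlinarith
  · right; constructor <;> nlinarith

/-- Two tour edges that lead from one corner of the square to the opposite one keep the greedy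
algorithm from expanding edges of cost at most `δ`. -/
theorem greedyTime_le_algTime {n : ℕ} {η δ : ℝ} (hη0 : 0 < η) (hη : η < 1 / 2)
    (hδ : δ + 5 * η ≤ √2)
    {ω : (Fin n → Plane) × Equiv.Perm (Fin n)} {i j : Fin n} (hij : i ≠ j)
    (hi : ω.1 (ω.2 i) ∈ box (Set.Icc 0 η)) (hi' : ω.1 (ω.2 (next i)) ∈ box (Set.Icc (1 - η) 1))
    (hj : ω.1 (ω.2 j) ∈ box (Set.Icc 0 η)) (hj' : ω.1 (ω.2 (next j)) ∈ box (Set.Icc (1 - η) 1))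
    {t : ℕ} (ht : (euclideanInstance ω).GreedyTime t) :
    t ≤ (euclideanInstance ω).algTime δ := by
  have h2 : √2 < 3 / 2 := by rw [Real.sqrt_lt' (by norm_num)]; norm_num
  -- Disjoint corners keep the two edges from being consecutive, so the move is legal.
  have hdisj : ∀ x : Plane, x ∈ box (Set.Icc 0 η) → x ∉ box (Set.Icc (1 - η) 1) := by
    intro x hx hx'
    have h1 := hx 0; have h2 := hx' 0
    simp only [Set.mem_Icc] at h1 h2
    linarith
  have hp : j ∈ partners i := by
    simp only [partners, List.mem_filter, List.mem_finRange, true_and, decide_eq_true_eq]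
    refine ⟨hij.symm, ?_, ?_⟩
    · rintro rfl; exact hdisj _ hj hi'
    · rintro rfl; exact hdisj _ hi hj'
  have d1 := le_dist_of_mem_box hη.le hi hi'
  have d2 := le_dist_of_mem_box hη.le hj hj'
  have d3 := dist_le_of_mem_box hη0.le hi hj
  have d4 := dist_le_of_mem_box (by linarith) hi' hj'
  refine Instance.GreedyTime.le_algTime _ hp ?_ ?_ ht
  · simp only [Instance.edgeCost, euclideanInstance]
    nlinarith
  -- The gain is at least `2 * √2 * (1 - 3 * η)`, and `3 * √2 < 5` explains the constant in `hδ`.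
  · simp only [Instance.gain, Instance.edgeCost, euclideanInstance]
    nlinarith

end TwoOpt

/-! ### Independence of coordinates under product measures. -/

theorem MeasureTheory.Measure.pi_eval_mem_and_eval_mem {ι X : Type*} [Fintype ι] [MeasurableSpace X]
    (μ : Measure X) [IsProbabilityMeasure μ] {a b : ι} (hab : a ≠ b) {A B : Set X}
    (hA : MeasurableSet A) (hB : MeasurableSet B) :
    Measure.pi (fun _ : ι => μ) {x | x a ∈ A ∧ x b ∈ B} = μ A * μ B := by
  have hind : iIndepFun (fun (i : ι) (x : ι → X) => x i) (Measure.pi fun _ => μ) :=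
    iIndepFun_pi (X := fun _ x => x) fun _ => aemeasurable_id
  have h := (hind.indepFun hab).measure_inter_preimage_eq_mul A B hA hB
  have he : ∀ (i : ι) (S : Set X), MeasurableSet S →
      Measure.pi (fun _ : ι => μ) ((fun x : ι → X => x i) ⁻¹' S) = μ S := fun i S hS =>
    (measurePreserving_eval (fun _ : ι => μ) i).measure_preimage hS.nullMeasurableSet
  rw [he a A hA, he b B hB] at h
  exact h

/-- Independent pairs of coordinates all miss `A ×ˢ B` with probability a power. -/
theorem MeasureTheory.Measure.pi_forall_not_mem_and_mem {ι κ X : Type*} [Fintype ι]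
    [MeasurableSpace X] (μ : Measure X) [IsProbabilityMeasure μ] {a b : κ → ι}
    (ha : Function.Injective a) (hb : Function.Injective b) (hab : ∀ k l, a k ≠ b l) {A B : Set X}
    (hA : MeasurableSet A) (hB : MeasurableSet B) (T : Finset κ) :
    Measure.pi (fun _ : ι => μ) {x | ∀ k ∈ T, ¬ (x (a k) ∈ A ∧ x (b k) ∈ B)} =
      (1 - μ A * μ B) ^ T.card := by
  classical
  have hind : iIndepFun (fun (i : ι) (x : ι → X) => x i) (Measure.pi fun _ => μ) :=
    iIndepFun_pi (X := fun _ x => x) fun _ => aemeasurable_id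
  have hpair : ∀ k, MeasurableSet {x : ι → X | x (a k) ∈ A ∧ x (b k) ∈ B} := fun k =>
    (measurable_pi_apply (a k) hA).inter (measurable_pi_apply (b k) hB)
  induction T using Finset.induction_on with
  | empty => simp
  | insert k T hk ih =>
    -- The new pair shares no coordinate with the earlier ones, so its event is independent of
    -- theirs.
    have hdisj : Disjoint {a k, b k} (T.image a ∪ T.image b) := by
      rw [Finset.disjoint_left]
      intro i hi hi'
      simp only [Finset.mem_insert, Finset.mem_singleton] at hi
      simp only [Finset.mem_union, Finset.mem_image] at hi'
      rcases hi with rfl | rfl <;> rcases hi' with ⟨l, hl, h⟩ | ⟨l, hl, h⟩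
      · exact hk (ha h ▸ hl)
      · exact hab _ _ h.symm
      · exact hab _ _ h
      · exact hk (hb h ▸ hl)
    have h := hind.indepFun_finset _ _ hdisj fun i => measurable_pi_apply i
    have h' := h.measure_inter_preimage_eq_mul
      {y | ¬ (y ⟨a k, by simp⟩ ∈ A ∧ y ⟨b k, by simp⟩ ∈ B)}
      (⋂ l : T, {y | ¬ (y ⟨a l, Finset.mem_union_left _ (Finset.mem_image_of_mem a l.2)⟩ ∈ A ∧
        y ⟨b l, Finset.mem_union_right _ (Finset.mem_image_of_mem b l.2)⟩ ∈ B)})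
      ((measurable_pi_apply _ hA).inter (measurable_pi_apply _ hB)).compl
      (MeasurableSet.iInter fun l =>
        ((measurable_pi_apply _ hA).inter (measurable_pi_apply _ hB)).compl)
    have e1 : {x : ι → X | ∀ l ∈ insert k T, ¬ (x (a l) ∈ A ∧ x (b l) ∈ B)} =
        {x | x (a k) ∈ A ∧ x (b k) ∈ B}ᶜ ∩ {x | ∀ l ∈ T, ¬ (x (a l) ∈ A ∧ x (b l) ∈ B)} := by
      ext x; simp
    rw [e1, Finset.card_insert_of_notMem hk, pow_succ', ← ih,
      ← Measure.pi_eval_mem_and_eval_mem μ (hab k k) hA hB, ← prob_compl_eq_one_sub (hpair k)]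
    have e2 : {x : ι → X | ∀ l ∈ T, ¬ (x (a l) ∈ A ∧ x (b l) ∈ B)} =
        ⋂ l : T, {x | ¬ (x (a l) ∈ A ∧ x (b l) ∈ B)} := by
      ext x; simp
    rw [e2]
    rw [Set.preimage_iInter] at h'
    exact h'

/-! ### The uniform law on the square and conditioning on the tour. -/

namespace TwoOpt

theorem box_eq_preimage (S : Set ℝ) : box S = WithLp.ofLp ⁻¹' (Set.univ.pi fun _ : Fin 2 => S) := by
  ext x; simp only [box, Set.mem_ofPred_eq, Set.mem_preimage, Set.mem_univ_pi]

theorem measurableSet_box {S : Set ℝ} (hS : MeasurableSet S) : MeasurableSet (box S) := by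
  rw [box_eq_preimage]
  exact (PiLp.volume_preserving_ofLp (Fin 2)).measurable (.univ_pi fun _ => hS)

theorem volume_box {S : Set ℝ} (hS : MeasurableSet S) :
    (volume : Measure Plane) (box S) = volume S ^ 2 := by
  rw [box_eq_preimage, (PiLp.volume_preserving_ofLp (Fin 2)).measure_preimage
    (MeasurableSet.univ_pi fun _ => hS).nullMeasurableSet, volume_pi_pi]
  simp

/-- The uniform law on the unit square. -/
noncomputable def squareLaw : Measure Plane := cond (volume : Measure Plane) unitSquare

theorem measurableSet_unitSquare : MeasurableSet unitSquare := measurableSet_box measurableSet_Icc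

theorem volume_unitSquare : (volume : Measure Plane) unitSquare = 1 := by
  rw [show unitSquare = box (Set.Icc 0 1) from rfl, volume_box measurableSet_Icc]
  simp

instance : IsProbabilityMeasure squareLaw :=
  cond_isProbabilityMeasure_of_finite (by simp [volume_unitSquare])
    (by simp [volume_unitSquare])

theorem squareLaw_box {S : Set ℝ} (hS : MeasurableSet S) :
    squareLaw (box S) = volume (Set.Icc 0 1 ∩ S) ^ 2 := by
  rw [squareLaw, cond_apply measurableSet_unitSquare, volume_unitSquare, inv_one, one_mul,
    ← volume_box (measurableSet_Icc.inter hS)]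
  congr 1
  ext x; simp [unitSquare, box, forall_and]

instance (n : ℕ) : IsProbabilityMeasure (euclideanLaw n) := by
  change IsProbabilityMeasure ((Measure.pi fun _ : Fin n => squareLaw).prod
    (ProbabilityTheory.uniformOn Set.univ))
  infer_instance

/-- Bounds for the conditional probabilities given the tour bound the probability. -/
theorem euclideanLaw_le {n : ℕ} {S : Set ((Fin n → Plane) × Equiv.Perm (Fin n))}
    (hS : MeasurableSet S) {q : ENNReal}
    (h : ∀ σ, Measure.pi (fun _ : Fin n => squareLaw) {P | (P, σ) ∈ S} ≤ q) :
    euclideanLaw n S ≤ q := by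
  change ((Measure.pi fun _ : Fin n => squareLaw).prod (ProbabilityTheory.uniformOn Set.univ)) S ≤ q
  rw [Measure.prod_apply_symm hS]
  exact (lintegral_mono h).trans (by simp)

theorem le_euclideanLaw {n : ℕ} {S : Set ((Fin n → Plane) × Equiv.Perm (Fin n))}
    (hS : MeasurableSet S) {q : ENNReal}
    (h : ∀ σ, q ≤ Measure.pi (fun _ : Fin n => squareLaw) {P | (P, σ) ∈ S}) :
    q ≤ euclideanLaw n S := by
  change q ≤ ((Measure.pi fun _ : Fin n => squareLaw).prod (ProbabilityTheory.uniformOn Set.univ)) S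
  rw [Measure.prod_apply_symm hS]
  exact le_trans (by simp) (lintegral_mono h)

theorem measurableSet_of_forall_perm {n : ℕ} {S : Set ((Fin n → Plane) × Equiv.Perm (Fin n))}
    (h : ∀ σ, MeasurableSet {P | (P, σ) ∈ S}) : MeasurableSet S := by
  have : S = ⋃ σ, {P | (P, σ) ∈ S} ×ˢ {σ} := by ext ⟨P, σ⟩; simp
  rw [this]
  exact MeasurableSet.iUnion fun σ => (h σ).prod MeasurableSpace.measurableSet_top

end TwoOpt

/-! ### Tail of the edge cost and bounds on the average time. -/

namespace TwoOpt

theorem squareLaw_corner {η : ℝ} (hη0 : 0 ≤ η) (hη : η ≤ 1) :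
    squareLaw (box (Set.Icc 0 η)) * squareLaw (box (Set.Icc (1 - η) 1)) =
      ENNReal.ofReal (η ^ 4) := by
  rw [squareLaw_box measurableSet_Icc, squareLaw_box measurableSet_Icc,
    Set.inter_eq_right.2 (Set.Icc_subset_Icc le_rfl hη),
    Set.inter_eq_right.2 (Set.Icc_subset_Icc (by linarith) le_rfl), Real.volume_Icc,
    Real.volume_Icc, sub_zero, sub_sub_cancel, ← pow_add, ENNReal.ofReal_pow hη0]

theorem measurableSet_edgeCost {n : ℕ} (δ : ℝ) (i : Fin n) :
    MeasurableSet {ω | δ < (euclideanInstance (n := n) ω).edgeCost i} := by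
  refine measurableSet_of_forall_perm fun σ => ?_
  change MeasurableSet {P : Fin n → Plane | δ < dist (P (σ i)) (P (σ (next i)))}
  exact measurableSet_lt measurable_const
    ((measurable_pi_apply _).dist (measurable_pi_apply _))

theorem le_prob_edgeCost {n : ℕ} (hn : 2 ≤ n) {η δ : ℝ} (hη0 : 0 < η) (hη : η ≤ 1 / 2)
    (hδ : δ + 5 * η ≤ √2) (i : Fin n) :
    ENNReal.ofReal (η ^ 4) ≤
      euclideanLaw n {ω | δ < (euclideanInstance (n := n) ω).edgeCost i} := by
  refine le_euclideanLaw (measurableSet_edgeCost δ i) fun σ => ?_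
  rw [← squareLaw_corner hη0.le (by linarith), ← Measure.pi_eval_mem_and_eval_mem (ι := Fin n)
    squareLaw (a := σ i) (b := σ (next i)) (σ.injective.ne (next_ne hn i).symm)
    (measurableSet_box measurableSet_Icc) (measurableSet_box measurableSet_Icc)]
  refine measure_mono fun P hP => ?_
  change δ < dist (P (σ i)) (P (σ (next i)))
  have h1 := le_dist_of_mem_box hη hP.1 hP.2
  have h2 : √2 < 3 / 2 := by rw [Real.sqrt_lt' (by norm_num)]; norm_num
  nlinarith

theorem prob_edgeCost_le {n : ℕ} (hn : 2 ≤ n) {ε : ℝ} (hε0 : 0 ≤ ε) (hε : ε ≤ √2) (i : Fin n) :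
    euclideanLaw n {ω | √2 - ε < (euclideanInstance (n := n) ω).edgeCost i} ≤
      ENNReal.ofReal ((6 * ε) ^ 4) := by
  refine euclideanLaw_le (measurableSet_edgeCost _ i) fun σ => ?_
  set S : Set ℝ := Set.Icc 0 (3 * ε) ∪ Set.Icc (1 - 3 * ε) 1
  have hS : MeasurableSet S := measurableSet_Icc.union measurableSet_Icc
  have hbox : squareLaw (box S) ≤ ENNReal.ofReal (6 * ε) ^ 2 := by
    rw [squareLaw_box hS]
    gcongr
    refine (measure_mono Set.inter_subset_right).trans ((measure_union_le _ _).trans ?_)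
    rw [Real.volume_Icc, Real.volume_Icc, ← ENNReal.ofReal_add (by linarith) (by linarith)]
    exact ENNReal.ofReal_le_ofReal (by linarith)
  -- Points lie in the square only almost surely, so the inclusion of events below holds only almost
  -- everywhere.
  have hsq : ∀ u, ∀ᵐ P ∂(Measure.pi fun _ : Fin n => squareLaw), P u ∈ unitSquare := fun u =>
    (Measure.quasiMeasurePreserving_eval (fun _ : Fin n => squareLaw) u).ae
      (ae_cond_mem measurableSet_unitSquare)
  calc _ ≤ Measure.pi (fun _ : Fin n => squareLaw)
        {P | P (σ i) ∈ box S ∧ P (σ (next i)) ∈ box S} := by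
        refine measure_mono_ae ?_
        filter_upwards [hsq (σ i), hsq (σ (next i))] with P h1 h2 h
        have h : √2 - ε < dist (P (σ i)) (P (σ (next i))) := h
        exact ⟨mem_box_of_lt_dist hε h1 h2 h,
          mem_box_of_lt_dist hε h2 h1 (dist_comm (P (σ i)) _ ▸ h)⟩
    _ = squareLaw (box S) * squareLaw (box S) :=
        Measure.pi_eval_mem_and_eval_mem _ (σ.injective.ne (next_ne hn i).symm)
          (measurableSet_box hS) (measurableSet_box hS)
    _ ≤ ENNReal.ofReal (6 * ε) ^ 2 * ENNReal.ofReal (6 * ε) ^ 2 := mul_le_mul' hbox hbox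
    _ = _ := by rw [← pow_add, ENNReal.ofReal_pow (by positivity)]

theorem avgAlgTime_eq_sum (n : ℕ) (δ : ℝ) :
    avgAlgTime n δ = ∑ i : Fin n, ((partners i).length : ℝ) *
      (euclideanLaw n).real {ω | δ < (euclideanInstance (n := n) ω).edgeCost i} := by
  classical
  have h : ∀ ω : (Fin n → Plane) × Equiv.Perm (Fin n),
      ((euclideanInstance ω).algTime δ : ℝ) = ∑ i : Fin n,
        {ω | δ < (euclideanInstance (n := n) ω).edgeCost i}.indicator
          (fun _ => ((partners i).length : ℝ)) ω := fun ω => by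
    simp [Instance.algTime_eq_sum, Set.indicator_apply]
  simp only [avgAlgTime, h]
  rw [integral_finsetSum _ fun i _ =>
    (integrable_const _).indicator (measurableSet_edgeCost δ i)]
  refine Finset.sum_congr rfl fun i _ => ?_
  rw [integral_indicator_const _ (measurableSet_edgeCost δ i), smul_eq_mul, mul_comm]

theorem le_avgAlgTime {n : ℕ} (hn : 2 ≤ n) {η δ : ℝ} (hη0 : 0 < η) (hη : η ≤ 1 / 2)
    (hδ : δ + 5 * η ≤ √2) : (n : ℝ) * ((n - 3) * η ^ 4) ≤ avgAlgTime n δ := by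
  rw [avgAlgTime_eq_sum]
  have h := Finset.card_nsmul_le_sum (Finset.univ : Finset (Fin n)) (fun i : Fin n =>
    ((partners i).length : ℝ) *
      (euclideanLaw n).real {ω | δ < (euclideanInstance (n := n) ω).edgeCost i})
    ((n - 3) * η ^ 4) fun i _ => by
      have h1 : (n : ℝ) ≤ (partners i).length + 3 := by exact_mod_cast le_length_partners i
      have h2 := (ENNReal.ofReal_le_iff_le_toReal (measure_ne_top _ _)).1
        (le_prob_edgeCost hn hη0 hη hδ i)
      calc _ ≤ ((partners i).length : ℝ) * η ^ 4 := by gcongr; linarith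
        _ ≤ _ := by gcongr; exact h2
  simpa using h

theorem avgAlgTime_le {n : ℕ} (hn : 2 ≤ n) {ε : ℝ} (hε0 : 0 ≤ ε) (hε : ε ≤ √2) :
    avgAlgTime n (√2 - ε) ≤ (n : ℝ) * (n * (6 * ε) ^ 4) := by
  rw [avgAlgTime_eq_sum]
  have h := Finset.sum_le_card_nsmul (Finset.univ : Finset (Fin n)) (fun i : Fin n =>
    ((partners i).length : ℝ) *
      (euclideanLaw n).real {ω | √2 - ε < (euclideanInstance (n := n) ω).edgeCost i})
    (n * (6 * ε) ^ 4) fun i _ => by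
      have h1 : ((partners i).length : ℝ) ≤ n := by exact_mod_cast length_partners_le i
      have h2 := ENNReal.toReal_le_of_le_ofReal (by positivity) (prob_edgeCost_le hn hε0 hε i)
      exact mul_le_mul h1 h2 measureReal_nonneg (by positivity)
  simpa using h

/-! ### Probability that two corner-to-corner edges exist. -/

/-- The instances in which none of the `m` tour edges at positions `s`, `s + 2`, `s + 4`, … leads
from the lower left corner of side `η` to the upper right one. -/
def missSet {n : ℕ} (η : ℝ) (m s : ℕ) (h : s + 2 * m ≤ n) :
    Set ((Fin n → Plane) × Equiv.Perm (Fin n)) :=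
  {ω | ∀ k : Fin m, ¬ (ω.1 (ω.2 ⟨s + 2 * k, by omega⟩) ∈ box (Set.Icc 0 η) ∧
    ω.1 (ω.2 ⟨s + 2 * k + 1, by omega⟩) ∈ box (Set.Icc (1 - η) 1))}

theorem measurableSet_missSet {n : ℕ} (η : ℝ) (m s : ℕ) (h : s + 2 * m ≤ n) :
    MeasurableSet (missSet η m s h) := by
  refine measurableSet_of_forall_perm fun σ => ?_
  rw [show {P | (P, σ) ∈ missSet η m s h} = ⋂ k : Fin m,
    {P | ¬ (P (σ ⟨s + 2 * k, by omega⟩) ∈ box (Set.Icc 0 η) ∧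
      P (σ ⟨s + 2 * k + 1, by omega⟩) ∈ box (Set.Icc (1 - η) 1))} by ext P; simp [missSet]]
  have hbox (u : Fin n) (a b : ℝ) :
      MeasurableSet ((fun P : Fin n → Plane => P u) ⁻¹' box (Set.Icc a b)) :=
    measurable_pi_apply u (measurableSet_box measurableSet_Icc)
  exact MeasurableSet.iInter fun k => ((hbox _ _ _).inter (hbox _ _ _)).compl

theorem prob_missSet_le {n : ℕ} {η : ℝ} (hη0 : 0 ≤ η) (hη : η ≤ 1) (m s : ℕ)
    (h : s + 2 * m ≤ n) : (euclideanLaw n).real (missSet η m s h) ≤ Real.exp (-(m * η ^ 4)) := by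
  have h1 : η ^ 4 ≤ 1 := pow_le_one₀ hη0 hη
  have key : euclideanLaw n (missSet η m s h) ≤ ENNReal.ofReal ((1 - η ^ 4) ^ m) := by
    refine euclideanLaw_le (measurableSet_missSet η m s h) fun σ => ?_
    have := Measure.pi_forall_not_mem_and_mem squareLaw
      (a := fun k : Fin m => σ ⟨s + 2 * k, by omega⟩)
      (b := fun k : Fin m => σ ⟨s + 2 * k + 1, by omega⟩)
      (fun k l hkl => by simpa [Fin.ext_iff] using hkl)
      (fun k l hkl => by simpa [Fin.ext_iff] using hkl)
      (fun k l hkl => by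
        have := Fin.ext_iff.1 (σ.injective hkl)
        simp only at this
        omega)
      (measurableSet_box (measurableSet_Icc (a := 0) (b := η)))
      (measurableSet_box (measurableSet_Icc (a := 1 - η) (b := 1))) Finset.univ
    rw [squareLaw_corner hη0 hη, ← ENNReal.ofReal_one, ← ENNReal.ofReal_sub _ (by positivity),
      ← ENNReal.ofReal_pow (by linarith), Finset.card_univ, Fintype.card_fin] at this
    rw [← this]
    exact measure_mono fun P hP k _ => hP k
  refine (ENNReal.toReal_le_of_le_ofReal (pow_nonneg (sub_nonneg.2 h1) m) key).trans ?_
  rw [← mul_neg, Real.exp_nat_mul]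
  gcongr
  linarith [Real.add_one_le_exp (-η ^ 4)]

theorem le_prob_greedyTime_le_algTime {n : ℕ} {η δ : ℝ} (hη0 : 0 < η) (hη : η < 1 / 2)
    (hδ : δ + 5 * η ≤ √2) {m : ℕ} (hm : 4 * m ≤ n) :
    1 - 2 * Real.exp (-(m * η ^ 4)) ≤ (euclideanLaw n).real
      {ω | ∀ t : ℕ, (euclideanInstance ω).GreedyTime t →
        t ≤ (euclideanInstance ω).algTime δ} := by
  -- One hit in each of two disjoint blocks of positions yields two distinct edges, with only a
  -- union bound needed.
  set M := missSet (n := n) η m 0 (by omega) ∪ missSet η m (2 * m) (by omega)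
  have hM : MeasurableSet M := (measurableSet_missSet ..).union (measurableSet_missSet ..)
  have hsub : Mᶜ ⊆ {ω : (Fin n → Plane) × Equiv.Perm (Fin n) |
      ∀ t : ℕ, (euclideanInstance ω).GreedyTime t → t ≤ (euclideanInstance ω).algTime δ} := by
    intro ω hω t ht
    simp only [M, Set.mem_compl_iff, Set.mem_union, not_or, missSet, Set.mem_ofPred_eq,
      not_forall, not_not] at hω
    obtain ⟨⟨k, hk, hk'⟩, l, hl, hl'⟩ := hω
    refine greedyTime_le_algTime hη0 hη hδ (i := ⟨0 + 2 * k, by omega⟩)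
      (j := ⟨2 * m + 2 * l, by omega⟩) ?_ hk ?_ hl ?_ ht
    · simp only [ne_eq, Fin.mk.injEq]; omega
    · rwa [next_mk (by omega)]
    · rwa [next_mk (by omega)]
  refine le_trans ?_ (measureReal_mono hsub)
  rw [probReal_compl_eq_one_sub hM]
  have h1 := prob_missSet_le (n := n) hη0.le (by linarith) m 0 (by omega)
  have h2 := prob_missSet_le (n := n) hη0.le (by linarith) m (2 * m) (by omega)
  have h3 : (euclideanLaw n).real M ≤ _ := measureReal_union_le _ _
  linarith

/-! ### Asymptotics at the threshold and choice of `c`. -/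

theorem rpow_neg_quarter_pow_four (n : ℕ) : ((n : ℝ) ^ (-(1 / 4 : ℝ))) ^ 4 = (n : ℝ)⁻¹ := by
  rw [← Real.rpow_natCast, ← Real.rpow_mul n.cast_nonneg, ← Real.rpow_neg_one]
  norm_num

theorem avgAlgTime_threshold_isTheta {c : ℝ} (hc : 0 < c) :
    (fun n : ℕ => avgAlgTime n (threshold c n)) =Θ[atTop] (fun n : ℕ => (n : ℝ)) := by
  have hlim : Tendsto (fun n : ℕ => c * (n : ℝ) ^ (-(1 / 4 : ℝ))) atTop (nhds 0) := by
    simpa using ((tendsto_rpow_neg_atTop (by norm_num : (0 : ℝ) < 1 / 4)).comp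
      tendsto_natCast_atTop_atTop).const_mul c
  have hev : ∀ᶠ n : ℕ in atTop, 6 ≤ n ∧ c * (n : ℝ) ^ (-(1 / 4 : ℝ)) < 1 :=
    (eventually_ge_atTop 6).and (hlim.eventually_lt_const one_pos)
  have hs : 1 ≤ √2 := Real.one_le_sqrt.2 (by norm_num)
  -- Here `1250 = 2 * 5 ^ 4`: the side is `η = c * n ^ (-1/4) / 5`, and `n - 3 ≥ n / 2` once `n ≥
  -- 6`.
  have hlow : ∀ᶠ n : ℕ in atTop, c ^ 4 / 1250 * n ≤ avgAlgTime n (threshold c n) := by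
    filter_upwards [hev] with n ⟨hn, hε⟩
    have hn' : (6 : ℝ) ≤ n := by exact_mod_cast hn
    have hpos : 0 < c * (n : ℝ) ^ (-(1 / 4 : ℝ)) := by positivity
    refine le_trans ?_ (le_avgAlgTime (η := c * (n : ℝ) ^ (-(1 / 4 : ℝ)) / 5) (by omega)
      (by positivity) (by linarith) (by rw [threshold]; linarith))
    rw [div_pow, mul_pow, rpow_neg_quarter_pow_four]
    have : (n : ℝ) * ((n - 3) * (c ^ 4 * (n : ℝ)⁻¹ / 5 ^ 4)) = c ^ 4 / 625 * (n - 3) := by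
      field_simp; norm_num
    rw [this]
    nlinarith [pow_pos hc 4]
  constructor
  · refine IsBigO.of_bound (1296 * c ^ 4) ?_
    filter_upwards [hev, hlow] with n ⟨hn, hε⟩ hl
    have hn' : (6 : ℝ) ≤ n := by exact_mod_cast hn
    have h0 : 0 ≤ avgAlgTime n (threshold c n) := le_trans (by positivity) hl
    rw [Real.norm_of_nonneg h0, Real.norm_of_nonneg n.cast_nonneg]
    refine (avgAlgTime_le (by omega) (by positivity) (by linarith)).trans_eq ?_
    rw [mul_pow, mul_pow, rpow_neg_quarter_pow_four]
    field_simp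
    norm_num
  · refine IsBigO.of_bound (1250 / c ^ 4) ?_
    filter_upwards [hlow] with n hl
    have h0 : 0 ≤ avgAlgTime n (threshold c n) := le_trans (by positivity) hl
    rw [Real.norm_of_nonneg h0, Real.norm_of_nonneg n.cast_nonneg]
    calc (n : ℝ) = 1250 / c ^ 4 * (c ^ 4 / 1250 * n) := by field_simp
      _ ≤ _ := by gcongr

theorem eventually_le_prob_greedyTime_le_algTime {c : ℝ} (hc : 0 < c) :
    ∀ᶠ n : ℕ in atTop, 1 - 2 * Real.exp (-(c ^ 4 / 10000)) ≤ (euclideanLaw n).real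
      {ω | ∀ t : ℕ, (euclideanInstance ω).GreedyTime t →
        t ≤ (euclideanInstance ω).algTime (threshold c n)} := by
  have hlim : Tendsto (fun n : ℕ => c * (n : ℝ) ^ (-(1 / 4 : ℝ))) atTop (nhds 0) := by
    simpa using ((tendsto_rpow_neg_atTop (by norm_num : (0 : ℝ) < 1 / 4)).comp
      tendsto_natCast_atTop_atTop).const_mul c
  filter_upwards [eventually_ge_atTop 4, hlim.eventually_lt_const one_pos] with n hn hε
  have hn0 : 0 < n := by omega
  have hn' : (0 : ℝ) < n := by exact_mod_cast hn0
  refine le_trans ?_ (le_prob_greedyTime_le_algTime (η := c * (n : ℝ) ^ (-(1 / 4 : ℝ)) / 5)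
    (m := n / 4) (by positivity) (by linarith) (by rw [threshold]; linarith) (by omega))
  rw [div_pow, mul_pow, rpow_neg_quarter_pow_four]
  -- A crude bound on the floor, valid since `n ≥ 4`; it gives `10000 = 16 * 5 ^ 4`.
  have hm : (n : ℝ) ≤ 16 * (n / 4 : ℕ) := by
    have : n ≤ 16 * (n / 4) := by omega
    exact_mod_cast this
  have : c ^ 4 / 10000 ≤ (n / 4 : ℕ) * (c ^ 4 * (n : ℝ)⁻¹ / 5 ^ 4) := by
    calc c ^ 4 / 10000 = n / 16 * (c ^ 4 * (n : ℝ)⁻¹ / 5 ^ 4) := by field_simp; norm_num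
      _ ≤ _ := by gcongr; linarith
  gcongr

end TwoOpt

theorem mainTheorem2 (p : ℝ) (hp0 : 0 ≤ p) (hp1 : p < 1) :
    ∃ c : ℝ, 0 < c ∧
      (fun n : ℕ => TwoOpt.avgAlgTime n (TwoOpt.threshold c n)) =Θ[atTop] (fun n : ℕ => (n : ℝ)) ∧
      ∃ n₀ : ℕ, ∀ n : ℕ, n₀ ≤ n →
        p < (TwoOpt.euclideanLaw n).real
          {ω | ∀ t : ℕ, (TwoOpt.euclideanInstance ω).GreedyTime t →
            t ≤ (TwoOpt.euclideanInstance ω).algTime (TwoOpt.threshold c n)} := by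
  -- Chosen so that `2 * exp (-L) = 1 - p`; the factor 10 in `c` cancels the 10000, leaving `(1 + L)
  -- ^ 4 > L`.
  set L := Real.log (2 / (1 - p))
  have hL : 0 < L := Real.log_pos (by rw [lt_div_iff₀] <;> linarith)
  have hc : 0 < 10 * (1 + L) := by positivity
  refine ⟨10 * (1 + L), hc, TwoOpt.avgAlgTime_threshold_isTheta hc, ?_⟩
  obtain ⟨n₀, h⟩ := eventually_atTop.1 (TwoOpt.eventually_le_prob_greedyTime_le_algTime hc)
  refine ⟨n₀, fun n hn => lt_of_lt_of_le ?_ (h n hn)⟩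
  have h1 : L < (10 * (1 + L)) ^ 4 / 10000 := by
    rw [mul_pow]
    have := le_self_pow₀ (show 1 ≤ 1 + L by linarith) (show 4 ≠ 0 by norm_num)
    linarith
  have h2 : Real.exp (-((10 * (1 + L)) ^ 4 / 10000)) < Real.exp (-L) :=
    Real.exp_lt_exp.2 (neg_lt_neg h1)
  rw [Real.exp_neg L, Real.exp_log (div_pos two_pos (by linarith)), inv_div] at h2
  linarith
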